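/- Let $X$ be a real Banach space with continuous dual $X^*$, and let $F:X\times X\to\mathbb{R}$ satisfy $F(x,x)=0$ for all $x\in X$ and be monotone, that is, $F(x,y)+F(y,x)\le 0$ for all $x,y\in X$. Define the set-valued operator $A^F:X\rightrightarrows X^*$ by $$A^F(x)=\{x^*\in X^*: F(x,y)-F(x,x)\ge \langle x^*,y-x\rangle\ \text{ for all } y\in X\}.$$ Assume that $A^F(x)\neq\emptyset$ for every $x\in X$ (i.e. $D(A^F)=X$), and that for every $y\in X$ the function $F(\cdot,y)$ is upper hemicontinuous, i.e. its restriction to every line segment $[a,b]\subseteq X$ is upper semicontinuous. Then $F$ is maximal monotone, that is, $A^F$ is a maximal monotone operator: $\langle y^*-x^*,y-x\rangle\ge 0$ whenever $x^*\in A^F(x)$ and $y^*\in A^F(y)$, and the graph $\{(x,x^*)\in X\times X^*: x^*\in A^F(x)\}$ is not properly included in the graph of any other monotone operator $S:X\rightrightarrows X^*$. -/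

import Mathlib

namespace MonotoneBifunctions

section Operators

variable {X : Type*} [NormedAddCommGroup X] [NormedSpace ℝ X]

/-- The graph of a multifunction from `X` to its continuous dual. -/
def graph (T : X → Set (StrongDual ℝ X)) : Set (X × StrongDual ℝ X) :=
  {p | p.2 ∈ T p.1}

/-- The domain of a multifunction: the points with a nonempty value. -/
def domain (T : X → Set (StrongDual ℝ X)) : Set X :=
  {x | (T x).Nonempty}

/-- Monotonicity of a multifunction from `X` to its continuous dual. -/
def IsMonotoneOperator (T : X → Set (StrongDual ℝ X)) : Prop :=
  ∀ x y : X, ∀ xs ∈ T x, ∀ ys ∈ T y, 0 ≤ (ys - xs) (y - x)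

/-- A monotone operator is maximal when its graph is not properly included in the graph of any
monotone operator. -/
def IsMaximalMonotoneOperator (T : X → Set (StrongDual ℝ X)) : Prop :=
  IsMonotoneOperator T ∧
    ∀ S : X → Set (StrongDual ℝ X), IsMonotoneOperator S → ¬ graph T ⊂ graph S

/-- Upper hemicontinuity of a real function: upper semicontinuity on line segments. -/
def IsUpperHemicontinuous (f : X → ℝ) : Prop :=
  ∀ a b : X, UpperSemicontinuousOn f (segment ℝ a b)

/-- The operator `A^F` attached to a bifunction `F : X × X → ℝ`. -/
def bifunctionOperator (F : X → X → ℝ) (x : X) : Set (StrongDual ℝ X) :=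
  {xs | ∀ y : X, xs (y - x) ≤ F x y - F x x}

/-- Monotonicity of a bifunction. -/
def IsMonotoneBifunction (F : X → X → ℝ) : Prop :=
  ∀ x y : X, F x y + F y x ≤ 0

/-- A monotone bifunction is maximal monotone when the operator `A^F` is maximal monotone. -/
def IsMaximalMonotoneBifunction (F : X → X → ℝ) : Prop :=
  IsMonotoneBifunction F ∧ IsMaximalMonotoneOperator (bifunctionOperator F)

end Operators

end MonotoneBifunctions

open Filter Topology

namespace MonotoneBifunctions

variable {X : Type*} [NormedAddCommGroup X] [NormedSpace ℝ X]

/-! Maximality is a Minty-type argument. Let `(x, xs)` be monotonically related to the graph of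
`A^F`, and put `z = x + t(y - x)`, `0 < t < 1`. Any `zs ∈ A^F(z)` satisfies `zs (y - x) ≥ xs (y -
x)`, so `F z y ≥ (1 - t) * xs (y - x)`; upper semicontinuity along the segment lets `t → 0⁺`. -/

theorem IsMonotoneBifunction.isMonotoneOperator {F : X → X → ℝ} (hmono : IsMonotoneBifunction F)
    (hdiag : ∀ x : X, F x x = 0) : IsMonotoneOperator (bifunctionOperator F) := by
  intro x y xs hxs ys hys
  have h1 := hxs y
  have h2 := hys x
  have h3 := hmono x y
  rw [hdiag, sub_zero] at h1 h2
  rw [← neg_sub y x, map_neg] at h2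
  rw [sub_apply]
  linarith

/-- If `A^F` has full domain and `F(·, y)` is upper hemicontinuous, then every point of
`X × X*` monotonically related to the graph of `A^F` belongs to it. -/
theorem mem_bifunctionOperator_of_monotonically_related {F : X → X → ℝ}
    (hdiag : ∀ x : X, F x x = 0) (hdom : domain (bifunctionOperator F) = Set.univ)
    (husc : ∀ y : X, IsUpperHemicontinuous (fun x => F x y)) {x : X} {xs : StrongDual ℝ X}
    (h : ∀ z : X, ∀ zs ∈ bifunctionOperator F z, 0 ≤ (zs - xs) (z - x)) :
    xs ∈ bifunctionOperator F x := by
  intro y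
  rw [hdiag, sub_zero]
  by_contra! hlt
  -- For small `t > 0`, `m` will strictly separate `F z y` (below it) from `(1 - t) * xs (y - x)`
  -- (above it), contradicting `hbound`.
  obtain ⟨m, hm1, hm2⟩ := exists_between hlt
  have hbound : ∀ t ∈ Set.Ioo (0 : ℝ) 1,
      (1 - t) * xs (y - x) ≤ F (AffineMap.lineMap x y t) y := by
    intro t ht
    obtain ⟨zs, hzs⟩ : AffineMap.lineMap x y t ∈ domain (bifunctionOperator F) :=
      hdom ▸ Set.mem_univ _
    have h1 := h _ zs hzs
    have h2 := hzs y
    have e1 : AffineMap.lineMap x y t - x = t • (y - x) := by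
      simp [AffineMap.lineMap_apply]
    have e2 : y - AffineMap.lineMap x y t = (1 - t) • (y - x) := by
      rw [AffineMap.lineMap_apply, vsub_eq_sub, vadd_eq_add]
      module
    rw [hdiag, sub_zero, e2, map_smul, smul_eq_mul] at h2
    rw [e1, map_smul, smul_eq_mul, sub_apply] at h1
    have h3 : xs (y - x) ≤ zs (y - x) := by
      linarith [nonneg_of_mul_nonneg_right h1 ht.1]
    exact (mul_le_mul_of_nonneg_left h3 (sub_nonneg.2 ht.2.le)).trans h2
  have hIoo : ∀ᶠ t in 𝓝[>] (0 : ℝ), t ∈ Set.Ioo (0 : ℝ) 1 := Ioo_mem_nhdsGT one_pos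
  have hline : Tendsto (fun t : ℝ => AffineMap.lineMap x y t) (𝓝[>] 0) (𝓝[segment ℝ x y] x) := by
    refine tendsto_nhdsWithin_iff.2 ⟨?_, ?_⟩
    · have hc : Continuous (fun t : ℝ => (AffineMap.lineMap x y t : X)) :=
        AffineMap.lineMap_continuous
      have := hc.tendsto 0
      rw [AffineMap.lineMap_apply_zero] at this
      exact this.mono_left nhdsWithin_le_nhds
    · filter_upwards [hIoo] with t ht
      rw [segment_eq_image_lineMap]
      exact ⟨t, ⟨ht.1.le, ht.2.le⟩, rfl⟩
  have hF := hline.eventually (husc y x y x (left_mem_segment ℝ x y) m hm1)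
  have hlim : Tendsto (fun t : ℝ => (1 - t) * xs (y - x)) (𝓝[>] 0) (𝓝 (xs (y - x))) := by
    have hc : Continuous (fun t : ℝ => (1 - t) * xs (y - x)) := by fun_prop
    have := hc.tendsto 0
    rw [sub_zero, one_mul] at this
    exact this.mono_left nhdsWithin_le_nhds
  obtain ⟨t, ht, htF, htm⟩ := (hIoo.and (hF.and (hlim.eventually_const_lt hm2))).exists
  exact absurd (hbound t ht) (not_le.2 (htF.trans htm))

end MonotoneBifunctions

theorem mainTheorem3 {X : Type*} [NormedAddCommGroup X] [NormedSpace ℝ X] [CompleteSpace X]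
    (F : X → X → ℝ)
    (hmono : MonotoneBifunctions.IsMonotoneBifunction F)
    (hdiag : ∀ x : X, F x x = 0)
    (hdom : MonotoneBifunctions.domain (MonotoneBifunctions.bifunctionOperator F) = Set.univ)
    (husc : ∀ y : X, MonotoneBifunctions.IsUpperHemicontinuous (fun x => F x y)) :
    MonotoneBifunctions.IsMaximalMonotoneBifunction F := by
  refine ⟨hmono, hmono.isMonotoneOperator hdiag, fun S hS hsub => hsub.2 ?_⟩
  rintro ⟨x, xs⟩ hx
  refine MonotoneBifunctions.mem_bifunctionOperator_of_monotonically_related hdiag hdom husc ?_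
  exact fun z zs hzs => hS x z xs hx zs (hsub.1 (show (z, zs) ∈ _ from hzs))
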